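/- Let $n\ge 1$ and let $J\subseteq\{1,\dots,n-1\}$. Say that $\pi\in S_n$ has descent set $J$ if $J=\{i: 1\le i\le n-1,\ \pi(i)>\pi(i+1)\}$ (equivalently, if $J\cup\{n\}$ is the set of descents of $\pi$ under the convention that every $\pi\in S_n$ also has a descent at position $n$). For $d\mid n$ let $J^d$ be the set of the elements of $J$ divisible by $d$, write them as $j^d_1<j^d_2<\cdots<j^d_{|J^d|}$, and put $j^d_0=0$ and $j^d_{|J^d|+1}=n$. Then the number of $n$-cycles in $S_n$ (for $n=1$, the identity is the one $1$-cycle) with descent set $J$ is \[ \frac1n\sum_{d\mid n}\mu(d)\,(-1)^{|J|-|J^d|}\, \det\left[\binom{\frac nd-\frac{j^d_l}{d}}{\frac{j^d_{m+1}}{d}-\frac{j^d_l}{d}}\right]_{0\le l,m\le |J^d|}, \] where $\mu$ is the Möbius function and a binomial coefficient $\binom ab$ with $b<0$ is $0$. -/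

import Mathlib

/-- The descent set of a permutation `π` of `n` letters, as a set of positions in `{1, …, n}`:
a position `i < n` belongs to it if `π(i) > π(i + 1)`, and by convention position `n` always
does. Position `i` (counted from one) is the element `i - 1` of `Fin n`. -/
def descentSet {n : ℕ} (π : Equiv.Perm (Fin n)) : Finset ℕ :=
  {i ∈ Finset.Icc 1 n | i = n ∨ ∃ h : i < n, π ⟨i, h⟩ < π ⟨i - 1, by omega⟩}

/-- An `n`-cycle in the symmetric group on `n` letters: all letters lie on one cycle of `π`.
(For `n = 1` this is the identity, which `Equiv.Perm.IsCycle` would exclude.) -/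
def IsNCycle {n : ℕ} (π : Equiv.Perm (Fin n)) : Prop :=
  π.IsCycleOn Set.univ

/-- `J^d`, the set of the elements of `J` that are divisible by `d`. -/
def divPart (J : Finset ℕ) (d : ℕ) : Finset ℕ :=
  {j ∈ J | d ∣ j}

/-- The sequence `j_0 = 0, j_1, …, j_k, j_{k+1} = n`, where `j_1 < ⋯ < j_k` are the elements
of `K`. -/
def bracketed (n : ℕ) (K : Finset ℕ) : Fin (K.card + 2) → ℕ :=
  Fin.cons 0 (Fin.snoc (K.orderEmbOfFin rfl) n)

/-- The binomial coefficient `a choose b` with an integer lower index,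
which is zero when `b` is negative. -/
def chooseInt (a : ℕ) (b : ℤ) : ℤ :=
  if 0 ≤ b then (a.choose b.toNat : ℤ) else 0

/-- The `(k+1) × (k+1)` matrix with the entries
`(n/d - j_l/d choose j_{m+1}/d - j_l/d)`, `0 ≤ l, m ≤ k`, for the elements
`j_1 < ⋯ < j_k` of `J^d`. When `d` divides `n`, all divisions are exact. -/
def cycleDescentMatrix (n : ℕ) (J : Finset ℕ) (d : ℕ) :
    Matrix (Fin ((divPart J d).card + 1)) (Fin ((divPart J d).card + 1)) ℤ :=
  Matrix.of fun l m =>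
    let j := bracketed n (divPart J d)
    chooseInt (n / d - j l.castSucc / d)
      (((j m.succ / d : ℕ) : ℤ) - ((j l.castSucc / d : ℕ) : ℤ))

open Function

/-- The number of occurrences of the letter `c` among the first `n` letters of `w`. -/
def letterCount (n : ℕ) (w : ℕ → ℕ) (c : ℕ) : ℕ :=
  ((Finset.range n).filter fun i => w i = c).card

/-- The infinite words of period `n` whose first `n` letters rearrange those of `f`. -/
def circularWords (n : ℕ) (f : ℕ → ℕ) : Set (ℕ → ℕ) :=
  {w | Periodic w n ∧ letterCount n w = letterCount n f}

/-- All the periods of `w` are multiples of `n`. -/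
def IsPrimitive (n : ℕ) (w : ℕ → ℕ) : Prop :=
  ∀ p, Periodic w p → n ∣ p

/-- The permutation `π` is increasing on each fiber of `f`. -/
def IncreasingOnFibers {n : ℕ} (f : ℕ → ℕ) (π : Equiv.Perm (Fin n)) : Prop :=
  ∀ x y : Fin n, x < y → f x = f y → π x < π y

/-- The sequence of the values of `f` along the orbit of `x`. -/
def itinerary {n : ℕ} (f : ℕ → ℕ) (π : Equiv.Perm (Fin n)) (x : Fin n) : Lex (ℕ → ℕ) :=
  toLex fun k => f ((π ^ k) x)

/-- The word with its first letter removed. -/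
def shiftWord (t : Lex (ℕ → ℕ)) : Lex (ℕ → ℕ) := toLex fun k => t (k + 1)

theorem shiftWord_lt_of_head_eq {s t : Lex (ℕ → ℕ)} (h : s < t) (h0 : s 0 = t 0) :
    shiftWord s < shiftWord t := by
  obtain ⟨k, hk, hlt⟩ := h
  cases k with
  | zero => exact absurd hlt (by simpa using h0.ge)
  | succ k => exact ⟨k, fun j hj => hk (j + 1) (by simpa using hj), hlt⟩

theorem head_le_of_lt {s t : Lex (ℕ → ℕ)} (h : s < t) : s 0 ≤ t 0 := by
  obtain ⟨k, hk, hlt⟩ := h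
  cases k with
  | zero => exact hlt.le
  | succ k => exact (hk 0 (Nat.succ_pos k)).le

theorem shiftWord_itinerary {n : ℕ} (f : ℕ → ℕ) (π : Equiv.Perm (Fin n)) (x : Fin n) :
    shiftWord (itinerary f π x) = itinerary f π (π x) := by
  funext k
  change f ((π ^ (k + 1)) x) = f ((π ^ k) (π x))
  rw [pow_succ, Equiv.Perm.mul_apply]

theorem IsNCycle.isCycleOn_univ {n : ℕ} {π : Equiv.Perm (Fin n)} (h : IsNCycle π) :
    π.IsCycleOn ((Finset.univ : Finset (Fin n)) : Set (Fin n)) := by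
  simpa [IsNCycle] using h

theorem IsNCycle.exists_pow_eq {n : ℕ} {π : Equiv.Perm (Fin n)} (h : IsNCycle π) (x y : Fin n) :
    ∃ k < n, (π ^ k) x = y := by
  simpa using h.isCycleOn_univ.exists_pow_eq (Finset.mem_univ x) (Finset.mem_univ y)

theorem IsNCycle.pow_apply_eq_iff {n : ℕ} {π : Equiv.Perm (Fin n)} (h : IsNCycle π) (x : Fin n)
    (k : ℕ) : (π ^ k) x = x ↔ n ∣ k := by
  simpa using h.isCycleOn_univ.pow_apply_eq (Finset.mem_univ x) (n := k)

theorem IsNCycle.bijOn_pow {n : ℕ} {π : Equiv.Perm (Fin n)} (h : IsNCycle π) (x : Fin n) :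
    Set.BijOn (fun k => (π ^ k) x) (Finset.range n : Set ℕ) (Set.univ : Set (Fin n)) := by
  have hs : Set.SurjOn (fun k => (π ^ k) x) (Finset.range n : Set ℕ)
      ((Finset.univ : Finset (Fin n)) : Set (Fin n)) := by
    intro y _
    obtain ⟨k, hk, rfl⟩ := h.exists_pow_eq x y
    exact ⟨k, by simpa using hk, rfl⟩
  refine ⟨fun _ _ => Set.mem_univ _, ?_, by simpa using hs⟩
  exact Finset.injOn_of_surjOn_of_card_le _ (fun _ _ => by simp) hs (by simp)

theorem IncreasingOnFibers.pow_lt_pow {n : ℕ} {f : ℕ → ℕ} {π : Equiv.Perm (Fin n)}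
    (hπ : IncreasingOnFibers f π) {x y : Fin n} (hxy : x < y) :
    ∀ k, (∀ j < k, f ((π ^ j) x) = f ((π ^ j) y)) → (π ^ k) x < (π ^ k) y
  | 0, _ => by simpa using hxy
  | k + 1, h => by
    rw [pow_succ', Equiv.Perm.mul_apply, Equiv.Perm.mul_apply]
    exact hπ _ _ (hπ.pow_lt_pow hxy k fun j hj => h j (hj.trans (Nat.lt_succ_self k)))
      (h k (Nat.lt_succ_self k))

theorem itinerary_injective {n : ℕ} {f : ℕ → ℕ} {π : Equiv.Perm (Fin n)} (hc : IsNCycle π)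
    (hπ : IncreasingOnFibers f π) : Injective (itinerary f π) := by
  suffices H : ∀ x y : Fin n, x < y → itinerary f π x ≠ itinerary f π y by
    intro x y h
    rcases lt_trichotomy x y with hxy | hxy | hxy
    · exact absurd h (H x y hxy)
    · exact hxy
    · exact absurd h.symm (H y x hxy)
  intro x y hxy h
  have hlt : ∀ k, (π ^ k) x < (π ^ k) y := fun k =>
    hπ.pow_lt_pow hxy k fun j _ => congrFun h j
  obtain ⟨p, -, rfl⟩ := hc.exists_pow_eq x y
  have hmono : StrictMono fun i : ℕ => (π ^ (p * i)) x := by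
    refine strictMono_nat_of_lt_succ fun i => ?_
    have := hlt (p * i)
    rwa [← Equiv.Perm.mul_apply, ← pow_add] at this
  have h0 := hmono (Nat.zero_lt_of_lt x.2)
  have hn : (π ^ (p * n)) x = x := (hc.pow_apply_eq_iff x _).2 (dvd_mul_left n p)
  simp [hn] at h0

theorem itinerary_strictMono {n : ℕ} {f : ℕ → ℕ} (hf : Monotone f) {π : Equiv.Perm (Fin n)}
    (hc : IsNCycle π) (hπ : IncreasingOnFibers f π) : StrictMono (itinerary f π) := by
  intro x y hxy
  rcases lt_trichotomy (itinerary f π x) (itinerary f π y) with h | h | h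
  · exact h
  · exact absurd (itinerary_injective hc hπ h) hxy.ne
  · obtain ⟨k, hk, hlt⟩ := h
    have hle := hπ.pow_lt_pow hxy k fun j hj => (hk j hj).symm
    exact absurd (hf hle.le) (not_le.2 hlt)

theorem itinerary_pow {n : ℕ} (f : ℕ → ℕ) (π : Equiv.Perm (Fin n)) (x : Fin n) (i : ℕ) :
    itinerary f π ((π ^ i) x) = toLex fun k => f ((π ^ (i + k)) x) := by
  funext k
  change f ((π ^ k) ((π ^ i) x)) = f ((π ^ (i + k)) x)
  rw [add_comm, pow_add, Equiv.Perm.mul_apply]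

theorem letterCount_eq_card_filter_univ (n : ℕ) (f : ℕ → ℕ) (c : ℕ) :
    letterCount n f c = (Finset.univ.filter fun x : Fin n => f x = c).card := by
  rw [letterCount, ← Nat.Iio_eq_range, ← Fin.map_valEmbedding_univ, Finset.filter_map,
    Finset.card_map]
  rfl

theorem letterCount_comp_of_bijOn {n : ℕ} {f : ℕ → ℕ} {g : ℕ → Fin n}
    (hg : Set.BijOn g (Finset.range n : Set ℕ) Set.univ) :
    letterCount n (fun i => f (g i)) = letterCount n f := by
  funext c
  rw [letterCount_eq_card_filter_univ n f, letterCount]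
  refine Finset.card_bij (fun i _ => g i) ?_ ?_ ?_
  · intro i hi
    simpa using (Finset.mem_filter.1 hi).2
  · intro i hi j hj h
    exact hg.injOn (Finset.mem_filter.1 hi).1 (Finset.mem_filter.1 hj).1 h
  · intro x hx
    obtain ⟨i, hi, rfl⟩ := hg.surjOn (Set.mem_univ x)
    exact ⟨i, Finset.mem_filter.2 ⟨hi, by simpa using hx⟩, rfl⟩

theorem eq_of_monotone_of_card_fiber_eq {n : ℕ} {f g : Fin n → ℕ} (hf : Monotone f)
    (hg : Monotone g)
    (h : ∀ c, (Finset.univ.filter fun x => f x = c).card =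
      (Finset.univ.filter fun x => g x = c).card) : f = g := by
  have key : ∀ (c : ℕ) (u : Fin n → ℕ), (List.ofFn u).count c =
      (Finset.univ.filter fun x => u x = c).card := by
    intro c u
    rw [← Multiset.coe_count, ← Fin.univ_val_map, Multiset.count_map]
    simp only [eq_comm]
    rfl
  have hp : (List.ofFn f).Perm (List.ofFn g) :=
    List.perm_iff_count.2 fun c => by rw [key, key, h]
  have := hp.eq_of_pairwise' (List.pairwise_ofFn.2 fun i j hij => hf hij.le)
    (List.pairwise_ofFn.2 fun i j hij => hg hij.le)
  exact List.ofFn_injective this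

/-- The word read off along the orbit of a point under an `n`-cycle. -/
def orbitWord {n : ℕ} (f : ℕ → ℕ) (p : Equiv.Perm (Fin n) × Fin n) : ℕ → ℕ :=
  fun i => f ((p.1 ^ i) p.2)

theorem orbitWord_mem {n : ℕ} {f : ℕ → ℕ} {π : Equiv.Perm (Fin n)}
    (hc : IsNCycle π) (hπ : IncreasingOnFibers f π) (x : Fin n) :
    orbitWord f (π, x) ∈ circularWords n f ∧ IsPrimitive n (orbitWord f (π, x)) := by
  refine ⟨⟨fun i => ?_, letterCount_comp_of_bijOn (hc.bijOn_pow x)⟩, fun p hp => ?_⟩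
  · change f ((π ^ (i + n)) x) = f ((π ^ i) x)
    rw [pow_add, Equiv.Perm.mul_apply, (hc.pow_apply_eq_iff x n).2 dvd_rfl]
  · rw [← hc.pow_apply_eq_iff x]
    refine itinerary_injective hc hπ ?_
    rw [itinerary_pow]
    funext k
    change f ((π ^ (p + k)) x) = f ((π ^ k) x)
    rw [add_comm]
    exact hp k

theorem orbitWord_injOn {n : ℕ} {f : ℕ → ℕ} (hf : Monotone f) :
    Set.InjOn (orbitWord f)
      ({π : Equiv.Perm (Fin n) | IsNCycle π ∧ IncreasingOnFibers f π} ×ˢ Set.univ) := by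
  rintro ⟨π, x⟩ ⟨⟨hc, hπ⟩, -⟩ ⟨ρ, y⟩ ⟨⟨hc', hρ⟩, -⟩ h
  have hrange : ∀ (τ : Equiv.Perm (Fin n)) (z : Fin n), IsNCycle τ →
      Set.range (itinerary f τ) =
        Set.range fun i : ℕ => (toLex fun k => orbitWord f (τ, z) (i + k) : Lex (ℕ → ℕ)) := by
    intro τ z hτ
    ext t
    constructor
    · rintro ⟨u, rfl⟩
      obtain ⟨i, -, rfl⟩ := hτ.exists_pow_eq z u
      exact ⟨i, (itinerary_pow f τ z i).symm⟩
    · rintro ⟨i, rfl⟩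
      exact ⟨(τ ^ i) z, itinerary_pow f τ z i⟩
  have heq : itinerary f π = itinerary f ρ := by
    rw [← (itinerary_strictMono hf hc hπ).range_inj (itinerary_strictMono hf hc' hρ),
      hrange π x hc, hrange ρ y hc', h]
  have hinj := itinerary_injective hc hπ
  refine Prod.ext (Equiv.ext fun z => hinj ?_) (hinj ?_)
  · rw [← shiftWord_itinerary, heq, shiftWord_itinerary]
  · rw [show itinerary f π x = toLex (orbitWord f (π, x)) from rfl, h, heq]
    rfl

theorem IsPrimitive.injOn_shifts {n : ℕ} {w : ℕ → ℕ} (hper : Periodic w n)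
    (hw : IsPrimitive n w) :
    Set.InjOn (fun i : ℕ => (toLex fun k => w (i + k) : Lex (ℕ → ℕ))) (Finset.range n) := by
  suffices H : ∀ i j : ℕ, i ≤ j → j < n →
      (∀ k, w (i + k) = w (j + k)) → i = j by
    intro i hi j hj h
    have hi' : i < n := by simpa using hi
    have hj' : j < n := by simpa using hj
    rcases le_total i j with hij | hij
    · exact H i j hij hj' (congrFun h)
    · exact (H j i hij hi' fun k => (congrFun h k).symm).symm
  intro i j hij hj h
  have hp : Periodic w (j - i) := by
    intro k
    have h1 := h (k + n - i)
    rw [show i + (k + n - i) = k + n by omega,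
      show j + (k + n - i) = k + (j - i) + n by omega, hper, hper] at h1
    exact h1.symm
  have := Nat.eq_zero_of_dvd_of_lt (hw _ hp) (by omega)
  omega

theorem exists_orbitWord_eq {n : ℕ} (hn : 1 ≤ n) {f : ℕ → ℕ} (hf : Monotone f) {w : ℕ → ℕ}
    (hw : w ∈ circularWords n f) (hprim : IsPrimitive n w) :
    ∃ (π : Equiv.Perm (Fin n)) (x : Fin n),
      IsNCycle π ∧ IncreasingOnFibers f π ∧ orbitWord f (π, x) = w := by
  obtain ⟨hper, hcount⟩ := hw
  set s : ℕ → Lex (ℕ → ℕ) := fun i => toLex fun k => w (i + k) with hs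
  have hinj : Set.InjOn s (Finset.range n) := hprim.injOn_shifts hper
  have hsn : ∀ i, s (i + n) = s i := fun i => by
    funext k
    change w (i + n + k) = w (i + k)
    rw [add_right_comm]
    exact hper _
  have hsmod : ∀ i, s (i % n) = s i := (show Periodic s n from hsn).map_mod_nat
  have hshift : ∀ i, shiftWord (s i) = s (i + 1) := fun i => by
    funext k
    change w (i + (k + 1)) = w (i + 1 + k)
    congr 1
    ring
  have hcard : ((Finset.range n).image s).card = n := by
    rw [Finset.card_image_of_injOn hinj, Finset.card_range]
  set t := ((Finset.range n).image s).orderEmbOfFin hcard with ht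
  have hmem : ∀ i, ∃ x, t x = s i := fun i => by
    have : s i ∈ Set.range t := by
      rw [ht, Finset.range_orderEmbOfFin, Finset.coe_image]
      exact ⟨i % n, by simpa using Nat.mod_lt i hn, hsmod i⟩
    exact this
  have hval : ∀ x, ∃ i < n, t x = s i := fun x => by
    have := Finset.orderEmbOfFin_mem _ hcard x
    obtain ⟨i, hi, h⟩ := Finset.mem_image.1 this
    exact ⟨i, by simpa using hi, h.symm⟩
  choose g hg using hmem
  choose e he hte using hval
  have hge : ∀ x, g (e x) = x := fun x => t.injective (by rw [hg, ← hte])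
  have hgbij : Set.BijOn g (Finset.range n : Set ℕ) Set.univ := by
    refine ⟨fun _ _ => Set.mem_univ _, fun i hi j hj h => hinj hi hj ?_, fun x _ => ?_⟩
    · rw [← hg, ← hg, h]
    · exact ⟨e x, by simpa using he x, hge x⟩
  have hsurj : Surjective fun x => g (e x + 1) := by
    intro y
    refine ⟨g (e y + (n - 1)), t.injective ?_⟩
    change t (g (e (g (e y + (n - 1))) + 1)) = t y
    rw [hg, ← hshift, ← hte, hg, hshift, hte y, add_assoc, Nat.sub_add_cancel hn, hsn]
  set π : Equiv.Perm (Fin n) :=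
    Equiv.ofBijective _ (Finite.surjective_iff_bijective.1 hsurj) with hπ
  have htπ : ∀ x, t (π x) = shiftWord (t x) := fun x => by
    change t (g (e x + 1)) = _
    rw [hg, hte x, hshift]
  have hpow : ∀ i, (π ^ i) (g 0) = g i := by
    intro i
    induction i with
    | zero => rfl
    | succ i ih =>
      refine t.injective ?_
      rw [pow_succ', Equiv.Perm.mul_apply, ih, htπ, hg, hg, hshift]
  have hhead : ∀ x : Fin n, f x = t x 0 := by
    refine congrFun (eq_of_monotone_of_card_fiber_eq (f := fun x : Fin n => f x)
      (g := fun x => t x 0) (fun x y h => hf h) ?_ fun c => ?_)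
    · intro x y h
      rcases h.eq_or_lt with rfl | h
      · exact le_rfl
      · exact head_le_of_lt (t.strictMono h)
    · rw [← letterCount_eq_card_filter_univ, ← hcount, letterCount]
      refine Finset.card_bij (fun i _ => g i) ?_ ?_ ?_
      · intro i hi
        rw [Finset.mem_filter]
        refine ⟨Finset.mem_univ _, ?_⟩
        rw [hg]
        exact (Finset.mem_filter.1 hi).2
      · intro i hi j hj h
        exact hgbij.injOn (Finset.mem_filter.1 hi).1 (Finset.mem_filter.1 hj).1 h
      · intro x hx
        refine ⟨e x, Finset.mem_filter.2 ⟨Finset.mem_range.2 (he x), ?_⟩, hge x⟩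
        have := (Finset.mem_filter.1 hx).2
        rwa [hte] at this
  refine ⟨π, g 0, ?_, ?_, ?_⟩
  · refine ⟨by simp [Set.bijOn_univ], fun x _ y _ => ?_⟩
    have hx : Equiv.Perm.SameCycle π (g 0) x := ⟨(e x : ℤ), by simp [hpow, hge]⟩
    have hy : Equiv.Perm.SameCycle π (g 0) y := ⟨(e y : ℤ), by simp [hpow, hge]⟩
    exact hx.symm.trans hy
  · intro x y hxy hfxy
    rw [hhead, hhead] at hfxy
    rw [← t.lt_iff_lt, htπ, htπ]
    exact shiftWord_lt_of_head_eq (t.strictMono hxy) hfxy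
  · funext i
    change f ((π ^ i) (g 0)) = w i
    rw [hpow, hhead, hg]
    rfl

/-- The Gessel–Reutenauer correspondence for `n`-cycles: pointed `n`-cycles that are increasing
on the fibers of a monotone function correspond to primitive words with the same content. -/
theorem card_mul_ncard_increasingOnFibers {n : ℕ} (hn : 1 ≤ n) {f : ℕ → ℕ} (hf : Monotone f) :
    n * {π : Equiv.Perm (Fin n) | IsNCycle π ∧ IncreasingOnFibers f π}.ncard =
      {w | w ∈ circularWords n f ∧ IsPrimitive n w}.ncard := by
  have himage : orbitWord f ''
      ({π : Equiv.Perm (Fin n) | IsNCycle π ∧ IncreasingOnFibers f π} ×ˢ Set.univ) =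
      {w | w ∈ circularWords n f ∧ IsPrimitive n w} := by
    ext w
    constructor
    · rintro ⟨⟨π, x⟩, ⟨⟨hc, hπ⟩, -⟩, rfl⟩
      exact orbitWord_mem hc hπ x
    · rintro ⟨hw, hprim⟩
      obtain ⟨π, x, hc, hπ, h⟩ := exists_orbitWord_eq hn hf hw hprim
      exact ⟨(π, x), ⟨⟨hc, hπ⟩, Set.mem_univ x⟩, h⟩
  rw [← himage, (orbitWord_injOn hf).ncard_image, Set.ncard_prod, Set.ncard_univ,
    Nat.card_fin, mul_comm]

theorem exists_perm_comp_eq_of_card_fiber_eq {α : Type*} [Fintype α] {u v : α → ℕ}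
    (h : ∀ c, (Finset.univ.filter fun x => u x = c).card =
      (Finset.univ.filter fun x => v x = c).card) : ∃ σ : Equiv.Perm α, v ∘ σ = u := by
  have e : ∀ c, Nonempty ({x // u x = c} ≃ {x // v x = c}) := fun c =>
    ⟨Fintype.equivOfCardEq (by rw [Fintype.card_subtype, Fintype.card_subtype, h c])⟩
  refine ⟨(Equiv.sigmaFiberEquiv u).symm.trans
    ((Equiv.sigmaCongrRight fun c => (e c).some).trans (Equiv.sigmaFiberEquiv v)), ?_⟩
  funext x
  exact ((e (u x)).some ⟨x, rfl⟩).2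

theorem orbit_domMulAct_eq {α : Type*} [Fintype α] (v : α → ℕ) :
    MulAction.orbit (Equiv.Perm α)ᵈᵐᵃ v =
      {u | ∀ c, (Finset.univ.filter fun x => u x = c).card =
        (Finset.univ.filter fun x => v x = c).card} := by
  ext u
  constructor
  · rintro ⟨σ, rfl⟩ c
    refine Finset.card_bij (fun x _ => DomMulAct.mk.symm σ x) ?_ ?_ ?_
    · intro x hx
      exact Finset.mem_filter.2 ⟨Finset.mem_univ _, (Finset.mem_filter.1 hx).2⟩
    · intro x _ y _ h
      exact (DomMulAct.mk.symm σ).injective h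
    · intro y hy
      refine ⟨(DomMulAct.mk.symm σ).symm y, ?_, by simp⟩
      rw [Finset.mem_filter] at hy ⊢
      refine ⟨Finset.mem_univ _, ?_⟩
      rw [← hy.2]
      change v (DomMulAct.mk.symm σ ((DomMulAct.mk.symm σ).symm y)) = v y
      rw [Equiv.apply_symm_apply]
  · intro h
    obtain ⟨σ, rfl⟩ := exists_perm_comp_eq_of_card_fiber_eq h
    exact ⟨DomMulAct.mk σ, rfl⟩

theorem ncard_rearrangements_mul_prod_factorial {α : Type*} [Fintype α] (v : α → ℕ) {M : ℕ}
    (hM : ∀ x, v x < M) :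
    {u : α → ℕ | ∀ c, (Finset.univ.filter fun x => u x = c).card =
        (Finset.univ.filter fun x => v x = c).card}.ncard *
      ∏ c ∈ Finset.range M, (Finset.univ.filter fun x => v x = c).card.factorial =
      (Fintype.card α).factorial := by
  classical
  have hstab : Nat.card (MulAction.stabilizer (Equiv.Perm α)ᵈᵐᵃ v) =
      ∏ c ∈ Finset.range M, (Finset.univ.filter fun x => v x = c).card.factorial := by
    have h1 : Nat.card (MulAction.stabilizer (Equiv.Perm α)ᵈᵐᵃ v) =
        Fintype.card {g : Equiv.Perm α // v ∘ g = v} := by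
      rw [← Nat.card_eq_fintype_card]
      exact Nat.card_congr (Equiv.subtypeEquiv DomMulAct.mk.symm fun σ =>
        DomMulAct.mem_stabilizer_iff)
    rw [h1, DomMulAct.stabilizer_card']
    simp only [Fintype.card_subtype]
    refine Finset.prod_subset ?_ ?_
    · intro c hc
      obtain ⟨x, -, rfl⟩ := Finset.mem_image.1 hc
      exact Finset.mem_range.2 (hM x)
    · intro c _ hc
      have : (Finset.univ.filter fun x => v x = c) = ∅ := by
        refine Finset.filter_eq_empty_iff.2 fun x _ hx => hc ?_
        exact Finset.mem_image.2 ⟨x, Finset.mem_univ x, hx⟩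
      rw [this]
      rfl
  rw [← orbit_domMulAct_eq, ← MulAction.index_stabilizer, ← hstab, Subgroup.index_mul_card,
    Nat.card_congr DomMulAct.mk.symm, Nat.card_eq_fintype_card, Fintype.card_perm]

theorem restrict_image_circularWords {N : ℕ} (hN : 1 ≤ N) (v : ℕ → ℕ) :
    (fun (w : ℕ → ℕ) (i : Fin N) => w i) '' circularWords N v =
      {u : Fin N → ℕ | ∀ c, (Finset.univ.filter fun x => u x = c).card =
        (Finset.univ.filter fun x : Fin N => v x = c).card} := by
  ext u
  constructor
  · rintro ⟨w, hw, rfl⟩ c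
    rw [← letterCount_eq_card_filter_univ, ← letterCount_eq_card_filter_univ, hw.2]
  · intro hu
    have hval : ∀ i : Fin N, u ⟨i % N, Nat.mod_lt _ hN⟩ = u i := fun i => by
      congr 1
      exact Fin.ext (Nat.mod_eq_of_lt i.2)
    refine ⟨fun i => u ⟨i % N, Nat.mod_lt i hN⟩, ⟨fun i => by simp, ?_⟩, funext hval⟩
    funext c
    rw [letterCount_eq_card_filter_univ, letterCount_eq_card_filter_univ, ← hu c]
    simp only [hval]

theorem restrict_injOn_circularWords {N : ℕ} (hN : 1 ≤ N) (v : ℕ → ℕ) :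
    Set.InjOn (fun (w : ℕ → ℕ) (i : Fin N) => w i) (circularWords N v) := by
  intro w hw w' hw' h
  funext i
  rw [← hw.1.map_mod_nat, ← hw'.1.map_mod_nat]
  exact congrFun h ⟨i % N, Nat.mod_lt i hN⟩

theorem circularWords_finite {N : ℕ} (hN : 1 ≤ N) (v : ℕ → ℕ) : (circularWords N v).Finite := by
  refine Set.Finite.of_finite_image ?_ (restrict_injOn_circularWords hN v)
  rw [restrict_image_circularWords hN, ← orbit_domMulAct_eq]
  have : Finite (Equiv.Perm (Fin N))ᵈᵐᵃ := Finite.of_equiv _ DomMulAct.mk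
  exact Set.finite_range _

theorem ncard_circularWords_mul_prod_factorial {N : ℕ} (hN : 1 ≤ N) (v : ℕ → ℕ) {M : ℕ}
    (hM : ∀ x < N, v x < M) :
    (circularWords N v).ncard * ∏ c ∈ Finset.range M, (letterCount N v c).factorial =
      N.factorial := by
  have := ncard_rearrangements_mul_prod_factorial (fun x : Fin N => v x) fun x => hM x x.2
  rw [← restrict_image_circularWords hN,
    (restrict_injOn_circularWords hN v).ncard_image, Fintype.card_fin] at this
  simpa only [letterCount_eq_card_filter_univ] using this

theorem Function.Periodic.mul_left_nat {w : ℕ → ℕ} {p : ℕ} (hw : Periodic w p) (d : ℕ) :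
    Periodic w (d * p) := by
  simpa using hw.nat_mul d

theorem Function.Periodic.letterCount_mul {w : ℕ → ℕ} {p : ℕ} (hw : Periodic w p) (d c : ℕ) :
    letterCount (d * p) w c = d * letterCount p w c := by
  induction d with
  | zero => simp [letterCount]
  | succ d ih =>
    have : letterCount (d * p + p) w c = letterCount (d * p) w c + letterCount p w c := by
      simp only [letterCount, ← Nat.count_eq_card_filter_range]
      rw [Nat.count_add]
      congr 2
      funext k
      rw [add_comm, hw.mul_left_nat d k]
    rw [Nat.succ_mul, this, ih, Nat.succ_mul]

/-- The positive periods of a word are the multiples of the least one. -/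
theorem exists_periodic_iff_dvd {w : ℕ → ℕ} {n : ℕ} (hn : 1 ≤ n) (hw : Periodic w n) :
    ∃ p, p ∣ n ∧ ∀ q, Periodic w q ↔ p ∣ q := by
  classical
  have hex : ∃ p, 1 ≤ p ∧ Periodic w p := ⟨n, hn, hw⟩
  obtain ⟨hp1, hp⟩ := Nat.find_spec hex
  set p := Nat.find hex
  have key : ∀ q, Periodic w q ↔ p ∣ q := by
    intro q
    constructor
    · intro hq
      by_contra hdvd
      have hmod : Periodic w (q % p) := by
        intro i
        rw [← hp.mul_left_nat (q / p) (i + q % p), add_assoc, mul_comm, Nat.mod_add_div, hq]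
      refine Nat.find_min hex (Nat.mod_lt q hp1) ⟨?_, hmod⟩
      exact Nat.pos_of_ne_zero fun h => hdvd (Nat.dvd_of_mod_eq_zero h)
    · rintro ⟨k, rfl⟩
      rw [mul_comm]
      exact hp.mul_left_nat k
  exact ⟨p, (key n).1 hw, key⟩

theorem sum_moebius_periodic {w : ℕ → ℕ} {n : ℕ} (hn : 1 ≤ n) (hw : Periodic w n)
    [DecidablePred fun d => Periodic w (n / d)] [Decidable (IsPrimitive n w)] :
    ∑ d ∈ n.divisors, (if Periodic w (n / d) then ArithmeticFunction.moebius d else 0) =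
      if IsPrimitive n w then 1 else 0 := by
  obtain ⟨p, ⟨m, rfl⟩, hper⟩ := exists_periodic_iff_dvd hn hw
  have hp0 : 0 < p := Nat.pos_of_ne_zero (by rintro rfl; simp at hn)
  have hm0 : 0 < m := Nat.pos_of_ne_zero (by rintro rfl; simp at hn)
  have hprim : IsPrimitive (p * m) w ↔ m = 1 := by
    constructor
    · intro h
      have h1 := h p ((hper p).2 dvd_rfl)
      have := Nat.le_of_dvd hp0 h1
      nlinarith
    · rintro rfl q hq
      simpa using (hper q).1 hq
  have hset : (p * m).divisors.filter (fun d => Periodic w (p * m / d)) = m.divisors := by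
    ext d
    simp only [Finset.mem_filter, Nat.mem_divisors, hper]
    constructor
    · rintro ⟨⟨hd, h0⟩, k, hk⟩
      refine ⟨⟨k, ?_⟩, hm0.ne'⟩
      have := Nat.div_mul_cancel hd
      rw [hk] at this
      refine Nat.eq_of_mul_eq_mul_left hp0 ?_
      rw [← this]
      ring
    · rintro ⟨⟨k, rfl⟩, -⟩
      have hd0 : 0 < d := Nat.pos_of_ne_zero (by rintro rfl; simp at hm0)
      refine ⟨⟨⟨p * k, by ring⟩, by positivity⟩, k, ?_⟩
      rw [show p * (d * k) = d * (p * k) by ring, Nat.mul_div_cancel_left _ hd0]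
  rw [← Finset.sum_filter, hset, ← ArithmeticFunction.coe_mul_zeta_apply,
    ArithmeticFunction.moebius_mul_coe_zeta, ArithmeticFunction.one_apply]
  simp only [hprim]

theorem ncard_primitive_eq_sum_moebius {n : ℕ} (hn : 1 ≤ n) (f : ℕ → ℕ) :
    (({w | w ∈ circularWords n f ∧ IsPrimitive n w}.ncard : ℕ) : ℤ) =
      ∑ d ∈ n.divisors, ArithmeticFunction.moebius d *
        (({w | w ∈ circularWords n f ∧ Periodic w (n / d)}.ncard : ℕ) : ℤ) := by
  classical
  have hfin := circularWords_finite hn f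
  have key : ∀ P : (ℕ → ℕ) → Prop, (({w | w ∈ circularWords n f ∧ P w}.ncard : ℕ) : ℤ) =
      ∑ w ∈ hfin.toFinset, if P w then 1 else 0 := by
    intro P
    rw [Finset.sum_boole, ← Set.ncard_coe_finset]
    congr 2
    ext w
    simp
  simp only [key, Finset.mul_sum]
  rw [Finset.sum_comm]
  refine Finset.sum_congr rfl fun w hw => ?_
  have hw : w ∈ circularWords n f := by simpa using hw
  rw [← sum_moebius_periodic hn hw.1]
  simp only [mul_ite, mul_one, mul_zero]

theorem circularWords_periodic_eq {N d : ℕ} (hd : 1 ≤ d) (f v : ℕ → ℕ)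
    (hv : ∀ c, letterCount (d * N) f c = d * letterCount N v c) :
    {w | w ∈ circularWords (d * N) f ∧ Periodic w N} = circularWords N v := by
  ext w
  constructor
  · rintro ⟨⟨-, h⟩, hp⟩
    refine ⟨hp, funext fun c => ?_⟩
    have := congrFun h c
    rw [hp.letterCount_mul, hv] at this
    exact Nat.eq_of_mul_eq_mul_left hd this
  · rintro ⟨hp, h⟩
    refine ⟨⟨hp.mul_left_nat d, funext fun c => ?_⟩, hp⟩
    rw [hp.letterCount_mul, hv, h]

/-- The number of elements of `K` up to `x`. As a function of `x`, it is constant on the blocks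
into which `K` cuts the natural numbers. -/
def blockIndex (K : Finset ℕ) (x : ℕ) : ℕ := (K.filter fun k => k ≤ x).card

theorem blockIndex_monotone (K : Finset ℕ) : Monotone (blockIndex K) := fun _ _ hxy =>
  Finset.card_le_card fun _ hk =>
    Finset.mem_filter.2 ⟨(Finset.mem_filter.1 hk).1, (Finset.mem_filter.1 hk).2.trans hxy⟩

theorem blockIndex_le_card (K : Finset ℕ) (x : ℕ) : blockIndex K x ≤ K.card :=
  Finset.card_filter_le _ _

theorem blockIndex_lt_of_mem {K : Finset ℕ} {k x : ℕ} (hk : k ∈ K) (hx : x < k) :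
    blockIndex K x < blockIndex K k := by
  refine Finset.card_lt_card ⟨fun j hj => ?_, fun h => ?_⟩
  · rw [Finset.mem_filter] at hj ⊢
    exact ⟨hj.1, hj.2.trans hx.le⟩
  · have := (Finset.mem_filter.1 (h (Finset.mem_filter.2 ⟨hk, le_rfl⟩))).2
    omega

theorem blockIndex_eq_of_forall {K : Finset ℕ} {x y : ℕ}
    (h : ∀ k ∈ K, k ≤ x ↔ k ≤ y) : blockIndex K x = blockIndex K y := by
  rw [blockIndex, blockIndex, Finset.filter_congr h]

theorem descentSet_subset_insert_iff {n : ℕ} (K : Finset ℕ) (π : Equiv.Perm (Fin n)) :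
    descentSet π ⊆ insert n K ↔ IncreasingOnFibers (blockIndex K) π := by
  constructor
  · intro h
    have hstep : ∀ (i : ℕ) (hi : i + 1 < n), i + 1 ∉ K → π ⟨i, by omega⟩ < π ⟨i + 1, hi⟩ := by
      intro i hi hK
      by_contra hlt
      have hne : π ⟨i, by omega⟩ ≠ π ⟨i + 1, hi⟩ := fun he => by
        have := congrArg Fin.val (π.injective he)
        simp at this
      have hlt' : π ⟨i + 1, hi⟩ < π ⟨i, by omega⟩ := lt_of_le_of_ne (not_lt.1 hlt) hne.symm
      have hmem : i + 1 ∈ descentSet π :=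
        Finset.mem_filter.2 ⟨Finset.mem_Icc.2 ⟨by omega, hi.le⟩, Or.inr ⟨hi, hlt'⟩⟩
      rcases Finset.mem_insert.1 (h hmem) with h1 | h1
      · omega
      · exact hK h1
    have hgo : ∀ (m i : ℕ) (hi : i + m + 1 < n),
        blockIndex K i = blockIndex K (i + m + 1) →
        π ⟨i, by omega⟩ < π ⟨i + m + 1, hi⟩ := by
      intro m
      induction m with
      | zero =>
        intro i hi hb
        refine hstep i hi fun hK => ?_
        have := blockIndex_lt_of_mem hK (Nat.lt_succ_self i)
        simp only [add_zero] at this hb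
        omega
      | succ m ih =>
        intro i hi hb
        have h1 := blockIndex_monotone K (show i ≤ i + m + 1 by omega)
        have h2 := blockIndex_monotone K (show i + m + 1 ≤ i + (m + 1) + 1 by omega)
        refine (ih i (by omega) (by omega)).trans (hstep (i + m + 1) hi fun hK => ?_)
        have := blockIndex_lt_of_mem hK (Nat.lt_succ_self (i + m + 1))
        rw [show i + m + 1 + 1 = i + (m + 1) + 1 by omega] at this
        omega
    rintro ⟨x, hx⟩ ⟨y, hy⟩ hxy hb
    obtain ⟨m, rfl⟩ : ∃ m, y = x + m + 1 := ⟨y - x - 1, by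
      have : x < y := hxy
      omega⟩
    exact hgo m x hy hb
  · intro h i hi
    obtain ⟨hi1, hi2⟩ := Finset.mem_filter.1 hi
    rcases hi2 with rfl | ⟨hin, hlt⟩
    · exact Finset.mem_insert_self _ _
    · refine Finset.mem_insert_of_mem ?_
      by_contra hK
      have hi0 : 1 ≤ i := (Finset.mem_Icc.1 hi1).1
      refine lt_asymm hlt (h _ _ (Fin.mk_lt_mk.2 (by omega)) (blockIndex_eq_of_forall ?_))
      intro k hk
      have : k ≠ i := fun he => hK (he ▸ hk)
      change k ≤ i - 1 ↔ k ≤ i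
      omega

theorem sum_letterCount_range (n : ℕ) (f : ℕ → ℕ) (r : ℕ) :
    ∑ c ∈ Finset.range r, letterCount n f c = ((Finset.range n).filter fun i => f i < r).card := by
  rw [Finset.card_eq_sum_card_fiberwise (f := f) (t := Finset.range r)
    (fun i hi => by simpa using (Finset.mem_filter.1 hi).2)]
  refine Finset.sum_congr rfl fun c hc => ?_
  rw [letterCount, Finset.filter_filter]
  congr 1
  refine Finset.filter_congr fun i _ => ⟨?_, fun h => h.2⟩
  rintro rfl
  exact ⟨Finset.mem_range.1 hc, rfl⟩

theorem dvd_of_periodic_circularWord {N d : ℕ} {K : Finset ℕ} (hK : ∀ k ∈ K, k < d * N)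
    {w : ℕ → ℕ} (hw : w ∈ circularWords (d * N) (blockIndex K)) (hp : Periodic w N)
    {k : ℕ} (hk : k ∈ K) : d ∣ k := by
  have h1 : ∑ c ∈ Finset.range (blockIndex K k), letterCount (d * N) (blockIndex K) c = k := by
    rw [sum_letterCount_range]
    have : ((Finset.range (d * N)).filter fun i => blockIndex K i < blockIndex K k) =
        Finset.range k := by
      ext i
      rw [Finset.mem_filter, Finset.mem_range, Finset.mem_range]
      constructor
      · rintro ⟨-, h⟩
        by_contra hik
        exact absurd (blockIndex_monotone K (not_lt.1 hik)) (not_le.2 h)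
      · intro h
        exact ⟨h.trans (hK k hk), blockIndex_lt_of_mem hk h⟩
    rw [this, Finset.card_range]
  rw [← h1, ← hw.2]
  refine Finset.dvd_sum fun c _ => ?_
  rw [hp.letterCount_mul]
  exact dvd_mul_right _ _

theorem letterCount_comp_div {d : ℕ} (hd : 1 ≤ d) (v : ℕ → ℕ) (N c : ℕ) :
    letterCount (d * N) (fun x => v (x / d)) c = d * letterCount N v c := by
  simp only [letterCount, ← Nat.count_eq_card_filter_range]
  induction N with
  | zero => simp
  | succ N ih =>
    rw [Nat.mul_succ, Nat.count_add, ih, Nat.count_succ, mul_add]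
    congr 1
    have hdiv : ∀ k ∈ Finset.range d, (v ((d * N + k) / d) = c ↔ v N = c) := fun k hk => by
      rw [Nat.mul_add_div hd, Nat.div_eq_of_lt (Finset.mem_range.1 hk), add_zero]
    rw [Nat.count_eq_card_filter_range, Finset.filter_congr hdiv]
    split_ifs with h <;> simp [h]

theorem letterCount_blockIndex_of_dvd {d : ℕ} (hd : 1 ≤ d) {K : Finset ℕ} (hK : ∀ k ∈ K, d ∣ k)
    (N c : ℕ) : letterCount (d * N) (blockIndex K) c =
      d * letterCount N (fun x => blockIndex K (d * x)) c := by
  rw [← letterCount_comp_div hd]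
  congr 1
  funext x
  refine blockIndex_eq_of_forall fun k hk => ?_
  obtain ⟨m, rfl⟩ := hK k hk
  rw [Nat.mul_le_mul_left_iff hd, Nat.le_div_iff_mul_le hd, mul_comm]

/-- The product of `h` over the consecutive pairs of the sequence `a, L, n`. -/
def chainProd (h : ℕ → ℕ → ℤ) (n : ℕ) : ℕ → List ℕ → ℤ
  | a, [] => h a n
  | a, j :: L => h a j * chainProd h n j L

/-- The signed sum of `chainProd` over the sublists of a list, by recursion on the list. -/
def altChainSum (h : ℕ → ℕ → ℤ) (n : ℕ) : ℕ → List ℕ → ℤ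
  | a, [] => h a n
  | a, j :: L => h a j * altChainSum h n j L - altChainSum h n a L

theorem sum_powerset_chainProd (h : ℕ → ℕ → ℤ) (n : ℕ) (K : Finset ℕ) :
    ∀ a, ∑ T ∈ K.powerset, (-1) ^ (K.card + T.card) * chainProd h n a T.sort =
      altChainSum h n a K.sort := by
  induction K using Finset.induction_on_min with
  | empty => intro a; simp [chainProd, altChainSum]
  | insert j K hj ih =>
    intro a
    have hjK : j ∉ K := fun hm => lt_irrefl _ (hj j hm)
    rw [Finset.sum_powerset_insert hjK, Finset.sort_insert _ (fun b hb => (hj b hb).le) hjK,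
      altChainSum, ← ih a, ← ih j, Finset.card_insert_of_notMem hjK, add_comm, sub_eq_add_neg,
      Finset.mul_sum, ← Finset.sum_neg_distrib]
    congr 1
    · refine Finset.sum_congr rfl fun T hT => ?_
      have hT := Finset.mem_powerset.1 hT
      have hjT : j ∉ T := fun hm => hjK (hT hm)
      rw [Finset.sort_insert _ (fun b hb => (hj b (hT hb)).le) hjT, chainProd,
        Finset.card_insert_of_notMem hjT]
      ring
    · refine Finset.sum_congr rfl fun T _ => ?_
      ring

theorem det_hessenberg_eq_altChainSum (h : ℕ → ℕ → ℤ) :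
    ∀ (k : ℕ) (j : Fin (k + 2) → ℕ), (∀ i, h (j i) (j i) = 1) →
      (∀ i i', i < i' → h (j i') (j i) = 0) →
      (Matrix.of fun l m : Fin (k + 1) => h (j l.castSucc) (j m.succ)).det =
        altChainSum h (j (Fin.last _)) (j 0) (List.ofFn fun i : Fin k => j i.succ.castSucc) := by
  intro k
  induction k with
  | zero =>
    intro j _ _
    simp [altChainSum]
  | succ k ih =>
    intro j h1 h0
    have hA := ih (fun i => j i.succ) (fun i => h1 _) fun i i' hi => h0 _ _ (by simpa using hi)
    have hB := ih (Fin.cons (j 0) fun i : Fin (k + 1) => j i.succ.succ)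
      (by intro i; refine Fin.cases ?_ (fun i => ?_) i <;> simp [h1])
      (by
        intro i i'
        refine Fin.cases ?_ (fun i' => ?_) i'
        · intro hi; simp at hi
        · refine Fin.cases ?_ (fun i => ?_) i
          · intro _
            exact h0 _ _ (by simp)
          · intro hi
            exact h0 _ _ (by simpa using hi))
    rw [Matrix.det_succ_column_zero, Fin.sum_univ_succ, Fin.sum_univ_succ,
      Finset.sum_eq_zero, add_zero, List.ofFn_succ, altChainSum, sub_eq_add_neg]
    · congr 1
      · refine (congrArg₂ (· * ·) (one_mul _) ?_)
        refine Eq.trans ?_ hA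
        congr 1
      · have h11 : (Matrix.of fun l m : Fin (k + 1 + 1) => h (j l.castSucc) (j m.succ))
            (Fin.succ 0) 0 = 1 := h1 1
        rw [h11]
        refine Eq.trans ?_ (congrArg Neg.neg hB)
        rw [Fin.val_succ, Fin.val_zero, zero_add, pow_one, mul_one, neg_one_mul]
        congr 2
        ext l m
        refine Fin.cases ?_ (fun l => ?_) l
        · rfl
        · simp only [Matrix.submatrix_apply, Matrix.of_apply, Fin.cons_succ,
            Fin.succ_succAbove_succ, Fin.succAbove_zero, Fin.castSucc_succ]
    · intro i _
      have : h (j i.succ.succ.castSucc) (j (Fin.succ 0)) = 0 := h0 _ _ (by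
        rw [Fin.lt_def]; simp)
      simp only [Matrix.of_apply, this]
      ring

/-- The entry of the determinant attached to the pair `a, b`. -/
def gapChoose (n d a b : ℕ) : ℤ :=
  chooseInt (n / d - a / d) (((b / d : ℕ) : ℤ) - ((a / d : ℕ) : ℤ))

theorem gapChoose_self (n d a : ℕ) : gapChoose n d a a = 1 := by
  simp [gapChoose, chooseInt]

theorem gapChoose_eq_zero {n d a b : ℕ} (h : b / d < a / d) : gapChoose n d a b = 0 := by
  rw [gapChoose, chooseInt, if_neg (by omega)]

theorem gapChoose_mul {N d a b : ℕ} (hd : 1 ≤ d) (hab : a ≤ b) :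
    gapChoose (d * N) d (d * a) (d * b) = ((N - a).choose (b - a) : ℕ) := by
  simp only [gapChoose, chooseInt, Nat.mul_div_cancel_left _ hd]
  rw [if_pos (by omega)]
  congr 2
  omega

theorem blockIndex_insert_eq_zero_iff {j x : ℕ} {K : Finset ℕ} (hj : ∀ k ∈ K, j < k) :
    blockIndex (insert j K) x = 0 ↔ x < j := by
  rw [blockIndex, Finset.card_eq_zero, Finset.filter_eq_empty_iff]
  constructor
  · intro h
    exact not_le.1 (h (Finset.mem_insert_self j K))
  · intro hx k hk
    rcases Finset.mem_insert.1 hk with rfl | hk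
    · exact not_le.2 hx
    · exact not_le.2 (hx.trans (hj k hk))

theorem blockIndex_insert_of_le {j x : ℕ} {K : Finset ℕ} (hj : j ∉ K) (hx : j ≤ x) :
    blockIndex (insert j K) x = blockIndex K x + 1 := by
  rw [blockIndex, Finset.filter_insert, if_pos hx, Finset.card_insert_of_notMem]
  · rfl
  · exact fun h => hj (Finset.mem_filter.1 h).1

theorem prod_factorial_mul_chainProd {N d : ℕ} (hd : 1 ≤ d) (K : Finset ℕ) :
    ∀ a, a ≤ N → (∀ k ∈ K, d * a < k ∧ k < d * N ∧ d ∣ k) →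
      ((∏ c ∈ Finset.range (K.card + 1),
        ((Finset.Ico a N).filter fun x => blockIndex K (d * x) = c).card.factorial : ℕ) : ℤ) *
        chainProd (gapChoose (d * N) d) (d * N) (d * a) K.sort = ((N - a).factorial : ℕ) := by
  induction K using Finset.induction_on_min with
  | empty =>
    intro a ha _
    simp [blockIndex, chainProd, gapChoose_mul hd ha]
  | insert j K hj ih =>
    intro a ha hK
    have hjK : j ∉ K := fun hm => lt_irrefl _ (hj j hm)
    obtain ⟨haj, hjN, b, rfl⟩ := hK j (Finset.mem_insert_self _ _)
    have hab : a < b := Nat.lt_of_mul_lt_mul_left haj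
    have hbN : b < N := Nat.lt_of_mul_lt_mul_left hjN
    have hIH := ih b hbN.le fun k hk =>
      ⟨hj k hk, (hK k (Finset.mem_insert_of_mem hk)).2⟩
    have hzero : ((Finset.Ico a N).filter fun x => blockIndex (insert (d * b) K) (d * x) = 0) =
        Finset.Ico a b := by
      ext x
      rw [Finset.mem_filter, blockIndex_insert_eq_zero_iff hj, Finset.mem_Ico, Finset.mem_Ico,
        Nat.mul_lt_mul_left hd]
      omega
    have hsucc : ∀ c, ((Finset.Ico a N).filter fun x =>
        blockIndex (insert (d * b) K) (d * x) = c + 1) =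
        (Finset.Ico b N).filter fun x => blockIndex K (d * x) = c := by
      intro c
      ext x
      rw [Finset.mem_filter, Finset.mem_filter, Finset.mem_Ico, Finset.mem_Ico]
      rcases lt_or_ge x b with hx | hx
      · have : blockIndex (insert (d * b) K) (d * x) = 0 :=
          (blockIndex_insert_eq_zero_iff hj).2 ((Nat.mul_lt_mul_left hd).2 hx)
        omega
      · rw [blockIndex_insert_of_le hjK (Nat.mul_le_mul_left d hx)]
        omega
    rw [Finset.card_insert_of_notMem hjK, Finset.prod_range_succ', hzero,
      Finset.sort_insert _ (fun b hb => (hj b hb).le) hjK, chainProd, gapChoose_mul hd hab.le,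
      Nat.card_Ico]
    simp only [hsucc]
    have hchoose := Nat.choose_mul_factorial_mul_factorial (show b - a ≤ N - a by omega)
    rw [show N - a - (b - a) = N - b by omega] at hchoose
    rw [← hchoose]
    push_cast at hIH ⊢
    rw [← hIH]
    ring

theorem ncard_circularWords_blockIndex {N d : ℕ} (hN : 1 ≤ N) (hd : 1 ≤ d) {K : Finset ℕ}
    (hK : ∀ k ∈ K, 0 < k ∧ k < d * N ∧ d ∣ k) :
    (((circularWords N fun x => blockIndex K (d * x)).ncard : ℕ) : ℤ) =
      chainProd (gapChoose (d * N) d) (d * N) 0 K.sort := by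
  have h1 := ncard_circularWords_mul_prod_factorial hN (fun x => blockIndex K (d * x))
    (M := K.card + 1) fun x _ => Nat.lt_succ_of_le (blockIndex_le_card _ _)
  have h2 := prod_factorial_mul_chainProd hd K 0 (Nat.zero_le N) (by simpa using hK)
  rw [mul_zero, Nat.sub_zero, ← h1, mul_comm] at h2
  push_cast at h2
  refine (mul_right_cancel₀ ?_ (h2.trans ?_)).symm
  · exact Finset.prod_ne_zero_iff.2 fun c _ => by exact_mod_cast Nat.factorial_ne_zero _
  · simp only [letterCount, ← Finset.range_eq_Ico]

/-- The number of words of period `n / d` whose content is given by the blocks of `K`. -/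
theorem ncard_periodic_blockIndex {n d : ℕ} (hn : 1 ≤ n) (hdn : d ∣ n) {K : Finset ℕ}
    (hK : K ⊆ Finset.Icc 1 (n - 1)) :
    (({w | w ∈ circularWords n (blockIndex K) ∧ Periodic w (n / d)}.ncard : ℕ) : ℤ) =
      if ∀ k ∈ K, d ∣ k then chainProd (gapChoose n d) n 0 K.sort else 0 := by
  obtain ⟨N, rfl⟩ := hdn
  have hd : 1 ≤ d := Nat.pos_of_ne_zero (by rintro rfl; simp at hn)
  have hN : 1 ≤ N := Nat.pos_of_ne_zero (by rintro rfl; simp at hn)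
  have hlt : ∀ k ∈ K, 0 < k ∧ k < d * N := fun k hk => by
    have := Finset.mem_Icc.1 (hK hk)
    omega
  rw [Nat.mul_div_cancel_left _ hd]
  split_ifs with hdvd
  · rw [circularWords_periodic_eq hd _ _ (letterCount_blockIndex_of_dvd hd hdvd N)]
    exact ncard_circularWords_blockIndex hN hd fun k hk =>
      ⟨(hlt k hk).1, (hlt k hk).2, hdvd k hk⟩
  · have : {w | w ∈ circularWords (d * N) (blockIndex K) ∧ Periodic w N} = ∅ := by
      refine Set.eq_empty_of_forall_notMem fun w hw => hdvd fun k hk => ?_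
      exact dvd_of_periodic_circularWord (fun k hk => (hlt k hk).2) hw.1 hw.2 hk
    rw [this, Set.ncard_empty]
    rfl

/-- The number of `n`-cycles whose descents lie in `K ∪ {n}`. -/
theorem card_mul_ncard_descentSet_subset {n : ℕ} (hn : 1 ≤ n) {K : Finset ℕ}
    (hK : K ⊆ Finset.Icc 1 (n - 1)) :
    (n : ℤ) * (({π : Equiv.Perm (Fin n) | IsNCycle π ∧ descentSet π ⊆ insert n K}.ncard : ℕ) : ℤ) =
      ∑ d ∈ n.divisors, ArithmeticFunction.moebius d *
        if ∀ k ∈ K, d ∣ k then chainProd (gapChoose n d) n 0 K.sort else 0 := by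
  simp only [descentSet_subset_insert_iff]
  rw [← Nat.cast_mul, card_mul_ncard_increasingOnFibers hn (blockIndex_monotone K),
    ncard_primitive_eq_sum_moebius hn]
  refine Finset.sum_congr rfl fun d hd => ?_
  rw [ncard_periodic_blockIndex hn (Nat.dvd_of_mem_divisors hd) hK]

theorem sum_powerset_neg_one_pow_subset (D J : Finset ℕ) :
    ∑ K ∈ J.powerset, (-1 : ℤ) ^ (J.card + K.card) * (if D ⊆ K then 1 else 0) =
      if D = J then 1 else 0 := by
  simp only [mul_ite, mul_one, mul_zero]
  rw [← Finset.sum_filter]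
  by_cases hDJ : D ⊆ J
  · have hIcc : J.powerset.filter (fun K => D ⊆ K) = Finset.Icc D J := by
      ext K
      simp [and_comm]
    have hdisj : ∀ T ∈ (J \ D).powerset, Disjoint D T := fun T hT =>
      Finset.disjoint_of_subset_right (Finset.mem_powerset.1 hT) Finset.disjoint_sdiff
    rw [hIcc, Finset.Icc_eq_image_powerset hDJ, Finset.sum_image]
    · have : ∀ T ∈ (J \ D).powerset, (-1 : ℤ) ^ (J.card + (D ∪ T).card) =
          (-1) ^ (J.card + D.card) * (-1) ^ T.card := fun T hT => by
        rw [Finset.card_union_of_disjoint (hdisj T hT), ← pow_add, add_assoc]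
      rw [Finset.sum_congr rfl this, ← Finset.mul_sum, Finset.sum_powerset_neg_one_pow_card]
      by_cases h : D = J
      · subst h
        simp [← two_mul]
      · rw [if_neg h, if_neg, mul_zero]
        exact fun he => h (hDJ.antisymm (Finset.sdiff_eq_empty_iff_subset.1 he))
    · intro T hT T' hT' h
      have h1 := congrArg (· \ D) h
      simpa [Finset.union_sdiff_left, (hdisj T hT).symm.sdiff_eq_left,
        (hdisj T' hT').symm.sdiff_eq_left] using h1
  · rw [if_neg (by rintro rfl; exact hDJ subset_rfl), Finset.sum_eq_zero]
    intro K hK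
    rw [Finset.mem_filter, Finset.mem_powerset] at hK
    exact absurd (hK.2.trans hK.1) hDJ

theorem ncard_descentSet_eq_sum {n : ℕ} (hn : 1 ≤ n) {J : Finset ℕ}
    (hJ : J ⊆ Finset.Icc 1 (n - 1)) :
    (({π : Equiv.Perm (Fin n) | IsNCycle π ∧ descentSet π = insert n J}.ncard : ℕ) : ℤ) =
      ∑ K ∈ J.powerset, (-1) ^ (J.card + K.card) *
        (({π : Equiv.Perm (Fin n) | IsNCycle π ∧ descentSet π ⊆ insert n K}.ncard : ℕ) : ℤ) := by
  classical
  have key : ∀ P : Equiv.Perm (Fin n) → Prop, (({π | IsNCycle π ∧ P π}.ncard : ℕ) : ℤ) =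
      ∑ π ∈ Finset.univ.filter fun π : Equiv.Perm (Fin n) => IsNCycle π,
        if P π then 1 else 0 := by
    intro P
    rw [Finset.sum_boole, ← Set.ncard_coe_finset]
    congr 2
    ext π
    simp
  simp only [key, Finset.mul_sum]
  rw [Finset.sum_comm]
  refine Finset.sum_congr rfl fun π _ => ?_
  have hnJ : n ∉ J := fun h => by
    have := Finset.mem_Icc.1 (hJ h)
    omega
  have hnπ : n ∈ descentSet π :=
    Finset.mem_filter.2 ⟨Finset.mem_Icc.2 ⟨hn, le_rfl⟩, Or.inl rfl⟩
  have heq : descentSet π = insert n J ↔ (descentSet π).erase n = J := by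
    constructor
    · intro h
      rw [h, Finset.erase_insert hnJ]
    · intro h
      rw [← h, Finset.insert_erase hnπ]
  simp only [heq, Finset.subset_insert_iff]
  exact (sum_powerset_neg_one_pow_subset _ J).symm

theorem bracketed_strictMono {n : ℕ} (hn : 1 ≤ n) {K : Finset ℕ}
    (hK : K ⊆ Finset.Icc 1 (n - 1)) : StrictMono (bracketed n K) := by
  have hmem : ∀ i, 0 < K.orderEmbOfFin rfl i ∧ K.orderEmbOfFin rfl i < n := fun i => by
    have := Finset.mem_Icc.1 (hK (K.orderEmbOfFin_mem rfl i))
    omega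
  have hsnoc : StrictMono (Fin.snoc (K.orderEmbOfFin rfl) n : Fin (K.card + 1) → ℕ) := by
    intro x y
    refine Fin.lastCases ?_ (fun x => ?_) x
    · intro h
      exact absurd h (not_lt.2 (Fin.le_last y))
    · refine Fin.lastCases ?_ (fun y => ?_) y
      · intro _
        simpa using (hmem x).2
      · intro h
        simpa using h
  have hpos : ∀ i, 0 < (Fin.snoc (K.orderEmbOfFin rfl) n : Fin (K.card + 1) → ℕ) i := by
    intro i
    refine Fin.lastCases ?_ (fun i => ?_) i
    · simpa using Nat.pos_of_ne_zero (Nat.one_le_iff_ne_zero.1 hn)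
    · simpa using (hmem i).1
  intro x y
  refine Fin.cases ?_ (fun y => ?_) y
  · intro h
    exact absurd h (Fin.not_lt_zero x)
  · refine Fin.cases ?_ (fun x => ?_) x
    · exact fun _ => hpos y
    · exact fun h => hsnoc (Fin.succ_lt_succ_iff.1 h)

theorem det_cycleDescentMatrix {n : ℕ} (hn : 1 ≤ n) {J : Finset ℕ}
    (hJ : J ⊆ Finset.Icc 1 (n - 1)) {d : ℕ} (hd : d ∣ n) :
    (cycleDescentMatrix n J d).det =
      altChainSum (gapChoose n d) n 0 (divPart J d).sort := by
  have hd0 : 0 < d := Nat.pos_of_dvd_of_pos hd hn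
  have hK : divPart J d ⊆ Finset.Icc 1 (n - 1) := (Finset.filter_subset _ _).trans hJ
  have hmono := bracketed_strictMono hn hK
  have hdvd : ∀ i, d ∣ bracketed n (divPart J d) i := by
    intro i
    refine Fin.cases (dvd_zero d) (fun i => ?_) i
    refine Fin.lastCases ?_ (fun i => ?_) i
    · simpa [bracketed] using hd
    · have := (Finset.mem_filter.1 ((divPart J d).orderEmbOfFin_mem rfl i)).2
      simpa [bracketed] using this
  have hlast : bracketed n (divPart J d) (Fin.last _) = n := by
    rw [bracketed, ← Fin.succ_last, Fin.cons_succ, Fin.snoc_last]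
  have hlist : (List.ofFn fun i : Fin (divPart J d).card =>
      bracketed n (divPart J d) i.succ.castSucc) = (divPart J d).sort := by
    refine List.ext_getElem (by simp) fun i h1 h2 => ?_
    rw [List.getElem_ofFn, ← Fin.succ_castSucc]
    exact Fin.snoc_castSucc (α := fun _ => ℕ) _ _ _
  have := det_hessenberg_eq_altChainSum (gapChoose n d) _ (bracketed n (divPart J d))
    (fun i => gapChoose_self _ _ _) fun i i' hi => gapChoose_eq_zero
      ((Nat.div_lt_div_right hd0.ne' (hdvd i) (hdvd i')).2 (hmono hi))
  rw [hlast, hlist] at this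
  exact this

theorem theorem8 (n : ℕ) (hn : 1 ≤ n) (J : Finset ℕ) (hJ : J ⊆ Finset.Icc 1 (n - 1)) :
    (({π : Equiv.Perm (Fin n) | IsNCycle π ∧ descentSet π = insert n J}.ncard : ℕ) : ℚ) =
      1 / (n : ℚ) *
        ∑ d ∈ n.divisors,
          ((ArithmeticFunction.moebius d * (-1) ^ (J.card - (divPart J d).card) *
            (cycleDescentMatrix n J d).det : ℤ) : ℚ) := by
  have hn0 : (n : ℚ) ≠ 0 := by
    exact_mod_cast (Nat.pos_iff_ne_zero.1 hn)
  rw [one_div, eq_inv_mul_iff_mul_eq₀ hn0]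
  have hmain : (n : ℤ) *
      (({π : Equiv.Perm (Fin n) | IsNCycle π ∧ descentSet π = insert n J}.ncard : ℕ) : ℤ) =
      ∑ d ∈ n.divisors, (ArithmeticFunction.moebius d *
        (-1) ^ (J.card - (divPart J d).card) * (cycleDescentMatrix n J d).det : ℤ) := by
    have hK : ∀ K ∈ J.powerset, (n : ℤ) * ((-1) ^ (J.card + K.card) *
        (({π : Equiv.Perm (Fin n) | IsNCycle π ∧ descentSet π ⊆ insert n K}.ncard : ℕ) : ℤ)) =
        ∑ d ∈ n.divisors, ArithmeticFunction.moebius d * ((-1) ^ (J.card + K.card) *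
          if ∀ k ∈ K, d ∣ k then chainProd (gapChoose n d) n 0 K.sort else 0) := by
      intro K hK
      rw [mul_left_comm, card_mul_ncard_descentSet_subset hn ((Finset.mem_powerset.1 hK).trans hJ),
        Finset.mul_sum]
      exact Finset.sum_congr rfl fun d _ => mul_left_comm _ _ _
    rw [ncard_descentSet_eq_sum hn hJ, Finset.mul_sum, Finset.sum_congr rfl hK, Finset.sum_comm]
    refine Finset.sum_congr rfl fun d hd => ?_
    rw [det_cycleDescentMatrix hn hJ (Nat.dvd_of_mem_divisors hd), ← sum_powerset_chainProd,
      ← Finset.mul_sum, mul_assoc]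
    congr 1
    have hpow : J.powerset.filter (fun K => ∀ k ∈ K, d ∣ k) = (divPart J d).powerset := by
      ext K
      rw [Finset.mem_filter, Finset.mem_powerset, Finset.mem_powerset]
      constructor
      · rintro ⟨h1, h2⟩ k hk
        exact Finset.mem_filter.2 ⟨h1 hk, h2 k hk⟩
      · intro h
        exact ⟨fun k hk => (Finset.mem_filter.1 (h hk)).1,
          fun k hk => (Finset.mem_filter.1 (h hk)).2⟩
    simp only [mul_ite, mul_zero]
    rw [← Finset.sum_filter, hpow, Finset.mul_sum]
    refine Finset.sum_congr rfl fun K _ => ?_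
    have hle : (divPart J d).card ≤ J.card := Finset.card_filter_le _ _
    rw [← mul_assoc, ← pow_add]
    congr 2
    omega
  exact_mod_cast hmain
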